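/- Let $d\ge 1$, $\alpha\in(0,1]$, and let $\mathcal P_2(\mathbb R^d)$ be the set of Borel probability measures on $\mathbb R^d$ with finite second moment. For $\mu,\nu\in\mathcal P_2(\mathbb R^d)$ let $\Pi(\mu,\nu)$ be the set of couplings of $\mu$ and $\nu$, and for $\gamma\in\Pi(\mu,\nu)$ put $C_2(\gamma)=\big(\int|x-y|^2\,\gamma(dx,dy)\big)^{1/2}$. **Tangent space.** The tangent space $T_\mu$ at $\mu$ is the set of measurable maps $\psi:\mathbb R^d\to\mathcal P(\mathbb R^d)$ with $\iint|z|^2\psi_x(dz)\mu(dx)<\infty$, identified with the measures $\mu(dx)\psi_x(dz)$ on $\mathbb R^{2d}$; a map $\phi\in L^2((\mathbb R^d,\mu),\mathbb R^d)$ is identified with $\mu(dx)\delta_{\phi(x)}(dz)$. For $\psi,\psi'\in T_\mu$, $$d_\mu^2(\psi,\psi')=\inf_{\Gamma}\int|z-z'|^2\,\Gamma(dx,dz,dz'),$$ over probability measures $\Gamma$ on $(\mathbb R^d)^3$ with $(\pi_1,\pi_2)_\#\Gamma=\mu(dx)\psi_x(dz)$ and $(\pi_1,\pi_3)_\#\Gamma=\mu(dx)\psi'_x(dz)$.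 **Parallel transport.** Let $\eta$ be a probability measure on $C([0,1],\mathbb R^d)$ with $(e_0)_\#\eta=\mu$, where $e_t$ is evaluation at $t$. A parallel transport of $\psi\in T_\mu$ along $\eta$ is a probability measure $\Psi$ on $C([0,1],\mathbb R^{2d})$, concentrated on curves $(x(t),z(t))$ with $z\in C^1$, such that the law of the curve $x$ under $\Psi$ is $\eta$, $z'\equiv0$ $\Psi$-almost surely, and $(e_0)_\#\Psi=\mu(dx)\psi_x(dz)$. For $\gamma\in\Pi(\mu,\nu)$ and $\phi\in L^2((\mathbb R^d,\mu),\mathbb R^d)$, $\mathcal T^\gamma(\phi)\in T_\nu$ denotes the end point $(e_1)_\#\Psi$ of a parallel transport $\Psi$ of $\phi$ along a measure $\eta$ with $(e_0,e_1)_\#\eta=\gamma$ (this end point exists and depends only on $\gamma$ and $\phi$). **Differentiability.** $U:\mathcal P_2(\mathbb R^d)\to\mathbb R$ is differentiable at $\mu$, with derivative $D_\mu U(\mu)=\phi\in L^2((\mathbb R^d,\mu),\mathbb R^d)$, if there is a modulus of continuity $\omega$ such that for all $\nu\in\mathcal P_2(\mathbb R^d)$ and $\gamma\in\Pi(\mu,\nu)$,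 $$\Big|U(\nu)-U(\mu)-\int (y-x)\cdot\phi(x)\,\gamma(dx,dy)\Big|\le C_2(\gamma)\,\omega(C_2(\gamma)).$$ **The class $\mathcal C^{1,\alpha}$.** $U\in\mathcal C^{1,\alpha}(\mathcal P_2(\mathbb R^d))$ if $U$ is differentiable at every $\mu$ and $$I_\alpha(D_\mu U):=\sup_{\gamma}\frac{d_\nu\big(\mathcal T^\gamma(D_\mu U(\mu)),D_\mu U(\nu)\big)}{C_2(\gamma)^\alpha}<\infty,$$ the supremum being over all $\mu,\nu\in\mathcal P_2(\mathbb R^d)$ and all $\gamma\in\Pi(\mu,\nu)$ with $0<C_2(\gamma)\le1$ if $\alpha<1$, and with $0<C_2(\gamma)$ if $\alpha=1$. **Proposition.** The set $\mathcal C^{1,\alpha}(\mathcal P_2(\mathbb R^d))\cap L^\infty(\mathcal P_2(\mathbb R^d))$ of bounded functions in $\mathcal C^{1,\alpha}(\mathcal P_2(\mathbb R^d))$ is a vector subspace of the space of real functions on $\mathcal P_2(\mathbb R^d)$, $$\mathcal N(U):=\|U\|_\infty+\sup_{\mu\in\mathcal P_2(\mathbb R^d)}d_\mu(D_\mu U(\mu),0)+I_\alpha(D_\mu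 U)$$ is finite on it, where $\|U\|_\infty=\sup_\mu|U(\mu)|$, and $\mathcal N$ is a norm on it, for which it is complete. -/

import Mathlib

open MeasureTheory Set Filter Topology
open scoped ENNReal

noncomputable section

namespace WassersteinC1

/-- The state space `ℝᵈ` with its Euclidean structure. -/
abbrev E (d : ℕ) : Type := EuclideanSpace ℝ (Fin d)

/-- `𝒫₂(ℝᵈ)`: Borel probability measures on `ℝᵈ` with finite second moment. -/
abbrev P2 (d : ℕ) : Type :=
  {μ : Measure (E d) // IsProbabilityMeasure μ ∧ ∫⁻ x, ‖x‖ₑ ^ 2 ∂μ < ∞}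

/-- `γ ∈ Π(μ, ν)`: the probability measure `γ` on `ℝᵈ × ℝᵈ` has marginals `μ` and `ν`. -/
structure IsCoupling {d : ℕ} (μ ν : P2 d) (γ : Measure (E d × E d)) : Prop where
  isProb : IsProbabilityMeasure γ
  fst_eq : γ.map Prod.fst = μ.1
  snd_eq : γ.map Prod.snd = ν.1

/-- `C₂(γ) = (∫ |x - y|² γ(dx, dy))^{1/2}`. -/
def C2 {d : ℕ} (γ : Measure (E d × E d)) : ℝ :=
  Real.sqrt (∫ p, ‖p.1 - p.2‖ ^ 2 ∂γ)

/-! ### Tangent spaces -/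

/-- The tangent space `T_μ(𝒫₂(ℝᵈ))`. An element `ψ` (a measurable map `x ↦ ψ_x` into the
probability measures on `ℝᵈ` with `∫∫ |z|² ψ_x(dz) μ(dx) < ∞`) is represented, by
disintegration, by the probability measure `μ(dx) ψ_x(dz)` on `ℝᵈ × ℝᵈ`. -/
def Tan {d : ℕ} (μ : P2 d) : Type :=
  {ψ : Measure (E d × E d) //
    IsProbabilityMeasure ψ ∧ ψ.map Prod.fst = μ.1 ∧ ∫⁻ p, ‖p.2‖ₑ ^ 2 ∂ψ < ∞}

/-- `L²((ℝᵈ, μ), ℝᵈ)`. -/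
abbrev L2 {d : ℕ} (μ : P2 d) : Type := Lp (E d) 2 μ.1

/-- For `φ ∈ L²((ℝᵈ, μ), ℝᵈ)`, the deterministic element `μ(dx) δ_{φ(x)}(dz)` of the tangent
space at `μ`. -/
def det {d : ℕ} {μ : P2 d} (φ : L2 μ) : Tan μ :=
  ⟨μ.1.map (fun x => (x, φ x)), by
    have hφ : AEMeasurable (fun x => φ x) μ.1 := (Lp.aestronglyMeasurable φ).aemeasurable
    have hm : AEMeasurable (fun x => (x, φ x)) μ.1 := aemeasurable_id.prodMk hφ
    have := μ.2.1
    refine ⟨Measure.isProbabilityMeasure_map hm, ?_, ?_⟩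
    · rw [AEMeasurable.map_map_of_aemeasurable measurable_fst.aemeasurable hm]
      exact Measure.map_id
    · rw [lintegral_map' (by fun_prop) hm]
      have h := (Lp.memLp φ).2
      rw [eLpNorm_lt_top_iff_lintegral_rpow_enorm_lt_top (by norm_num) (by norm_num)] at h
      simpa using h⟩

/-- The distance `d_μ` on the tangent space at `μ`: the square root of the infimum of
`∫ |z - z'|² Γ(dx, dz, dz')` over the probability measures `Γ` on `(ℝᵈ)³` with
`(π₁, π₂)_# Γ = μ(dx) ψ_x(dz)` and `(π₁, π₃)_# Γ = μ(dx) ψ'_x(dz)`. -/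
def dTan {d : ℕ} {μ : P2 d} (ψ ψ' : Tan μ) : ℝ≥0∞ :=
  (⨅ (Γ : Measure (E d × E d × E d))
      (_ : IsProbabilityMeasure Γ ∧
        Γ.map (fun q => (q.1, q.2.1)) = ψ.1 ∧
        Γ.map (fun q => (q.1, q.2.2)) = ψ'.1),
    ∫⁻ q, ‖q.2.1 - q.2.2‖ₑ ^ 2 ∂Γ) ^ (1 / 2 : ℝ)

/-! ### Parallel transport -/

/-- Continuous curves `[0,1] → X`, with the compact-open (uniform) topology. -/
abbrev Curve (X : Type*) [TopologicalSpace X] : Type _ := C(unitInterval, X)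

/-- The space of curves carries its Borel `σ`-algebra. -/
instance (X : Type*) [TopologicalSpace X] : MeasurableSpace (Curve X) := borel _

instance (X : Type*) [TopologicalSpace X] : BorelSpace (Curve X) := ⟨rfl⟩

/-- The second component of a curve on `ℝᵈ × ℝᵈ`, as a function of a real variable (only its
values on `[0,1]` matter). -/
def snd' {d : ℕ} (w : Curve (E d × E d)) : ℝ → E d :=
  fun t => (w (projIcc 0 1 zero_le_one t)).2

/-- `Ψ` is a parallel transport of `ψ ∈ T_μ(𝒫₂(ℝᵈ))` along the Lagrangian curve `η`, a
probability measure on `C([0,1], ℝᵈ)` with `(e₀)_# η = μ`. -/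
structure IsParallelTransport {d : ℕ} {μ : P2 d} (ψ : Tan μ)
    (η : Measure (Curve (E d))) (Ψ : Measure (Curve (E d × E d))) : Prop where
  isProb : IsProbabilityMeasure Ψ
  /-- `Ψ` is concentrated on curves whose second component is `C¹`. -/
  concentrated : ∀ᵐ w ∂Ψ, ContDiffOn ℝ 1 (snd' w) (Icc 0 1)
  /-- `(p₁)_# Ψ = η`. -/
  base : Ψ.map (fun w => ContinuousMap.fst.comp w) = η
  /-- `(∂₂)_# Ψ = δ₀`: almost surely, the second component has derivative `0` on `[0,1]`. -/
  deriv_eq : ∀ᵐ w ∂Ψ, ∀ t ∈ Icc (0 : ℝ) 1, derivWithin (snd' w) (Icc 0 1) t = 0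
  /-- `(e₀)_# Ψ = μ(dx) ψ_x(dz)`. -/
  initial : Ψ.map (fun w => w 0) = ψ.1

/-- `ψ' ∈ T_ν(𝒫₂(ℝᵈ))` is the end point `(e₁)_# Ψ` of a parallel transport `Ψ` of
`ψ ∈ T_μ(𝒫₂(ℝᵈ))` along the coupling `γ`, that is, along some Lagrangian curve `η` with
`(e₀, e₁)_# η = γ`. -/
def IsTransported {d : ℕ} {μ ν : P2 d} (γ : Measure (E d × E d)) (ψ : Tan μ) (ψ' : Tan ν) :
    Prop :=
  ∃ (η : Measure (Curve (E d))) (Ψ : Measure (Curve (E d × E d))),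
    IsProbabilityMeasure η ∧ η.map (fun w => (w 0, w 1)) = γ ∧
    IsParallelTransport ψ η Ψ ∧ Ψ.map (fun w => w 1) = ψ'.1

/-! ### Differentiability -/

/-- A modulus of continuity. -/
structure IsModulus (ω : ℝ → ℝ) : Prop where
  mono : MonotoneOn ω (Ici 0)
  zero : ω 0 = 0
  cont : ContinuousWithinAt ω (Ici 0) 0

/-- `φ` is a derivative of `U` at `μ`. -/
def HasGrad {d : ℕ} (U : P2 d → ℝ) (μ : P2 d) (φ : L2 μ) : Prop :=
  ∃ ω : ℝ → ℝ, IsModulus ω ∧ ∀ (ν : P2 d) (γ : Measure (E d × E d)), IsCoupling μ ν γ →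
    |U ν - U μ - ∫ p, inner ℝ (p.2 - p.1) (φ p.1) ∂γ| ≤ C2 γ * ω (C2 γ)

open Classical in
/-- The derivative `D_μ U(μ) ∈ L²((ℝᵈ, μ), ℝᵈ)`, for `U` differentiable at `μ` (and `0` if it
is not). -/
def grad {d : ℕ} (U : P2 d → ℝ) (μ : P2 d) : L2 μ :=
  if h : ∃ φ : L2 μ, HasGrad U μ φ then h.choose else 0

/-! ### The class `C^{1,α}` and its norm -/

/-- The seminorm `I_α` of a field `μ ↦ Φ(μ) ∈ L²((ℝᵈ, μ), ℝᵈ)`: the supremum of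
`d_ν(𝒯^γ(Φ(μ)), Φ(ν)) / C₂(γ)^α` over the couplings `γ ∈ Π(μ, ν)`, `μ, ν ∈ 𝒫₂(ℝᵈ)`, with
`0 < C₂(γ)`, and moreover `C₂(γ) ≤ 1` if `α < 1`. -/
def Iα {d : ℕ} (α : ℝ) (Φ : ∀ μ : P2 d, L2 μ) : ℝ≥0∞ :=
  ⨆ (μ : P2 d) (ν : P2 d) (γ : Measure (E d × E d))
    (_ : IsCoupling μ ν γ ∧ 0 < C2 γ ∧ (α < 1 → C2 γ ≤ 1))
    (ψ : Tan ν) (_ : IsTransported γ (det (Φ μ)) ψ),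
    dTan ψ (det (Φ ν)) / ENNReal.ofReal (C2 γ ^ α)

/-- `U ∈ C^{1,α}(𝒫₂(ℝᵈ))`. -/
structure IsC1α {d : ℕ} (α : ℝ) (U : P2 d → ℝ) : Prop where
  differentiable : ∀ μ : P2 d, ∃ φ : L2 μ, HasGrad U μ φ
  finite : Iα α (grad U) < ∞

/-- `U ∈ L^∞(𝒫₂(ℝᵈ))`. -/
def IsBdd {d : ℕ} (U : P2 d → ℝ) : Prop := ∃ C : ℝ, ∀ μ, |U μ| ≤ C

/-- `𝒩(U) = ‖U‖_∞ + sup_μ d_μ(D_μ U(μ), 0) + I_α(D_μ U)`, a priori in `[0, ∞]`. -/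
def N {d : ℕ} (α : ℝ) (U : P2 d → ℝ) : ℝ≥0∞ :=
  (⨆ μ : P2 d, ‖U μ‖ₑ) + (⨆ μ : P2 d, dTan (det (grad U μ)) (det (0 : L2 μ))) + Iα α (grad U)

end WassersteinC1

end

noncomputable section

namespace WassersteinC1

variable {d : ℕ} {μ ν : P2 d} {γ : Measure (E d × E d)}

/-! Everything is read in the Hilbert space `L²(γ)` of a coupling. A parallel transport keeps `z`
constant, so the transport of a map `φ` along `γ` ends at the law of `(y, φ x)`, and its distance to
a map `φ'` is the `L²(γ)` norm of `φ x - φ' y` (`IsTransported.eq_map`,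
`IsCoupling.dTan_transported`). Hence `Iα` is a Hölder constant of the gradient field; gradients are
unique, so they depend linearly on `U` and `N` is a norm as soon as it is finite.

The analytic input is `IsC1α.taylor`: differentiating `U` along the displacement interpolation
bounds the first-order remainder by `Iα` times the power `1 + α` of `C2 γ`, when `C2 γ ≤ 1`. A unit
displacement in the direction of the gradient then bounds the gradient by twice the sup norm plus
`Iα`, so `N` is finite.

For completeness, the values and gradients of an `N`-Cauchy sequence converge at each `μ`, the
gradients in the complete space `L²(μ)`. The Taylor estimate yields a modulus depending only on a
bound for `N`, so the limit is differentiable and its gradient is the limit of the gradients. The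
bounds defining `N` pass to pointwise limits; used on `u n - u m` as `m` grows, this gives
convergence in `N`. -/

instance (μ : P2 d) : IsProbabilityMeasure μ.1 := μ.2.1

lemma measurable_coe_L2 (φ : L2 μ) : Measurable (φ : E d → E d) :=
  (Lp.stronglyMeasurable φ).measurable

/-! ### The distance on a tangent space and parallel transport, in terms of `L²` norms -/

lemma measurableSet_graph (φ : L2 μ) : MeasurableSet {p : E d × E d | p.2 = φ p.1} :=
  measurableSet_eq_fun measurable_snd ((measurable_coe_L2 φ).comp measurable_fst)

lemma det_val (φ : L2 μ) : (det φ).1 = μ.1.map fun x => (x, φ x) := rfl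

lemma ae_det (φ : L2 μ) : ∀ᵐ p ∂(det φ).1, p.2 = φ p.1 := by
  have hφ := measurable_coe_L2 φ
  rw [det_val, ae_map_iff (by fun_prop) (measurableSet_graph φ)]
  exact ae_of_all _ fun _ => rfl

/-- Under an admissible `Γ` the third coordinate is almost surely `φ` of the first, so all
admissible `Γ` have the same cost; the push-forward of `ψ` by `(x, z) ↦ (x, z, φ x)` is one of them.
-/
lemma dTan_det (ψ : Tan μ) (φ : L2 μ) :
    dTan ψ (det φ) = eLpNorm (fun p : E d × E d => p.2 - φ p.1) 2 ψ.1 := by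
  have hφ := measurable_coe_L2 φ
  rw [eLpNorm_eq_lintegral_rpow_enorm_toReal (by norm_num) (by norm_num)]
  simp only [ENNReal.toReal_ofNat, ENNReal.rpow_ofNat]
  unfold dTan
  congr 1
  obtain ⟨ψ, hψ, hψμ, hψ2⟩ := ψ
  change _ = ∫⁻ p, ‖p.2 - φ p.1‖ₑ ^ 2 ∂ψ
  apply le_antisymm
  · have hm : Measurable (fun p : E d × E d => (p.1, p.2, φ p.1)) := by fun_prop
    have hΓ : IsProbabilityMeasure (ψ.map fun p : E d × E d => (p.1, p.2, φ p.1)) ∧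
        (ψ.map fun p : E d × E d => (p.1, p.2, φ p.1)).map (fun q => (q.1, q.2.1)) = ψ ∧
        (ψ.map fun p : E d × E d => (p.1, p.2, φ p.1)).map (fun q => (q.1, q.2.2)) =
          (det φ).1 := by
      refine ⟨Measure.isProbabilityMeasure_map hm.aemeasurable, ?_, ?_⟩
      · rw [Measure.map_map (by fun_prop) hm]
        exact Measure.map_id
      · have hg : Measurable fun x : E d => (x, φ x) := by fun_prop
        rw [Measure.map_map (by fun_prop) hm, det_val]
        change _ = Measure.map (fun x => (x, φ x)) μ.1
        have := (congrArg (Measure.map fun x : E d => (x, φ x)) hψμ)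
        rw [← this, Measure.map_map hg measurable_fst]
        rfl
    refine le_trans (iInf₂_le (ψ.map fun p : E d × E d => (p.1, p.2, φ p.1)) hΓ) (le_of_eq ?_)
    rw [lintegral_map (by fun_prop) hm]
  · refine le_iInf₂ fun Γ hΓ => le_of_eq ?_
    obtain ⟨_, h12, h13⟩ := hΓ
    have hae := ae_det φ
    rw [← h13, ae_map_iff (by fun_prop) (measurableSet_graph φ)] at hae
    change Γ.map (fun q => (q.1, q.2.1)) = ψ at h12
    rw [← h12, lintegral_map (by fun_prop) (by fun_prop)]
    refine lintegral_congr_ae ?_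
    filter_upwards [hae] with q hq
    rw [hq]

lemma dTan_det_zero (φ : L2 μ) : dTan (det φ) (det (0 : L2 μ)) = ‖φ‖ₑ := by
  have hφ := measurable_coe_L2 φ
  have h0 := measurable_coe_L2 (0 : L2 μ)
  rw [dTan_det, Lp.enorm_def]
  rw [det_val, eLpNorm_map_measure (by fun_prop) (by fun_prop)]
  congr 1
  ext x
  simp

lemma measurable_curve_eval (t : unitInterval) :
    Measurable fun w : Curve (E d × E d) => w t :=
  (ContinuousEvalConst.continuous_eval_const t).measurable

lemma measurable_curve_fst :
    Measurable fun w : Curve (E d × E d) => (ContinuousMap.fst.comp w : Curve (E d)) :=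
  (ContinuousMap.continuous_postcomp _).measurable

lemma measurable_curve_endpoints :
    Measurable fun w : Curve (E d) => (w 0, w 1) :=
  ((ContinuousEvalConst.continuous_eval_const (0 : unitInterval)).measurable).prodMk
    (ContinuousEvalConst.continuous_eval_const (1 : unitInterval)).measurable

/-- The end point of a parallel transport of a map `φ` along `γ` is the law of `(y, φ x)`
under `γ(dx, dy)`. -/
lemma IsTransported.eq_map {φ : L2 μ} {ψ : Tan ν} (h : IsTransported γ (det φ) ψ) :
    ψ.1 = γ.map fun p => (p.2, φ p.1) := by
  obtain ⟨η, Ψ, -, hγ, hΨ, hψ⟩ := h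
  have hφ := measurable_coe_L2 φ
  have h0 : ∀ᵐ w ∂Ψ, (w 0).2 = φ (w 0).1 := by
    have hae := ae_det φ
    rwa [← hΨ.initial, ae_map_iff (measurable_curve_eval 0).aemeasurable
      (measurableSet_graph φ)] at hae
  have h1 : ∀ᵐ w ∂Ψ, (w 1).2 = (w 0).2 := by
    filter_upwards [hΨ.concentrated, hΨ.deriv_eq] with w hw hw'
    have := constant_of_derivWithin_zero (hw.differentiableOn (by norm_num))
      (fun t ht => hw' t (Ico_subset_Icc_self ht)) 1 (right_mem_Icc.2 zero_le_one)
    simpa [snd'] using this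
  rw [← hψ, ← hγ, ← hΨ.base, Measure.map_map measurable_curve_endpoints measurable_curve_fst,
    Measure.map_map (by fun_prop) (measurable_curve_endpoints.comp measurable_curve_fst)]
  refine Measure.map_congr ?_
  filter_upwards [h0, h1] with w hw0 hw1
  simp only [Function.comp_apply, ContinuousMap.comp_apply]
  exact Prod.ext rfl (hw1.trans hw0)

lemma IsCoupling.mpFst (h : IsCoupling μ ν γ) : MeasurePreserving Prod.fst γ μ.1 :=
  ⟨measurable_fst, h.fst_eq⟩

lemma IsCoupling.mpSnd (h : IsCoupling μ ν γ) : MeasurePreserving Prod.snd γ ν.1 :=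
  ⟨measurable_snd, h.snd_eq⟩

/-- The affine curve from `x` to `y`, with the constant vector `z` attached. -/
def affineCurve (d : ℕ) : C(E d × E d × E d, Curve (E d × E d)) :=
  ContinuousMap.curry ⟨fun q : (E d × E d × E d) × unitInterval =>
    (q.1.1 + (q.2 : ℝ) • (q.1.2.1 - q.1.1), q.1.2.2), by fun_prop⟩

@[simp] lemma affineCurve_apply (q : E d × E d × E d) (t : unitInterval) :
    affineCurve d q t = (q.1 + (t : ℝ) • (q.2.1 - q.1), q.2.2) := rfl

/-- Without a transport along every coupling, the supremum in `Iα` could be over an empty set and a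
bound on it would say nothing. Straight lines carrying a constant vector suffice. -/
lemma IsCoupling.exists_isTransported (h : IsCoupling μ ν γ) (φ : L2 μ) :
    ∃ ψ : Tan ν, IsTransported γ (det φ) ψ := by
  have hφ := measurable_coe_L2 φ
  have hγ := h.isProb
  have hend : Measurable fun p : E d × E d => (p.2, φ p.1) := by fun_prop
  have hF : Measurable fun p : E d × E d => affineCurve d (p.1, p.2, φ p.1) :=
    (affineCurve d).continuous.measurable.comp (by fun_prop)
  refine ⟨⟨γ.map fun p => (p.2, φ p.1), Measure.isProbabilityMeasure_map hend.aemeasurable,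
    ?_, ?_⟩, ?_⟩
  · rw [Measure.map_map measurable_fst hend]
    exact h.snd_eq
  · rw [lintegral_map (by fun_prop) hend]
    have h1 := (det φ).2.2.2
    change ∫⁻ p, ‖p.2‖ₑ ^ 2 ∂(μ.1.map fun x => (x, φ x)) < ∞ at h1
    rw [lintegral_map (by fun_prop) (by fun_prop)] at h1
    exact (h.mpFst.lintegral_comp (f := fun x => ‖φ x‖ₑ ^ 2) (by fun_prop)).trans_lt h1
  · have hΨ : IsProbabilityMeasure (γ.map fun p => affineCurve d (p.1, p.2, φ p.1)) :=
      Measure.isProbabilityMeasure_map hF.aemeasurable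
    have hconst : ∀ᵐ w ∂(γ.map fun p => affineCurve d (p.1, p.2, φ p.1)),
        snd' w = fun _ => (w 0).2 := by
      -- Closedness provides the measurability needed to move the uncountable quantifier over `t`
      -- through the push-forward.
      have hcl : IsClosed {w : Curve (E d × E d) | ∀ t, (w t).2 = (w 0).2} := by
        simp only [ofPred_forall]
        exact isClosed_iInter fun t => isClosed_eq
          (continuous_snd.comp (ContinuousEvalConst.continuous_eval_const t))
          (continuous_snd.comp (ContinuousEvalConst.continuous_eval_const 0))
      have hae : ∀ᵐ w ∂(γ.map fun p => affineCurve d (p.1, p.2, φ p.1)),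
          ∀ t, (w t).2 = (w 0).2 := by
        rw [ae_map_iff hF.aemeasurable hcl.measurableSet]
        exact ae_of_all _ fun _ _ => rfl
      filter_upwards [hae] with w hw
      exact funext fun t => hw _
    refine ⟨(γ.map fun p => affineCurve d (p.1, p.2, φ p.1)).map
      (fun w => ContinuousMap.fst.comp w), γ.map fun p => affineCurve d (p.1, p.2, φ p.1),
      Measure.isProbabilityMeasure_map measurable_curve_fst.aemeasurable, ?_,
      ⟨hΨ, ?_, rfl, ?_, ?_⟩, ?_⟩
    · rw [Measure.map_map measurable_curve_endpoints measurable_curve_fst,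
        Measure.map_map (measurable_curve_endpoints.comp measurable_curve_fst) hF]
      convert Measure.map_id
      ext p <;> simp
    · filter_upwards [hconst] with w hw
      rw [hw]
      exact contDiffOn_const
    · filter_upwards [hconst] with w hw t _
      rw [hw]
      simp
    · rw [Measure.map_map (measurable_curve_eval 0) hF]
      have hg : Measurable fun x : E d => (x, φ x) := by fun_prop
      have := congrArg (Measure.map fun x : E d => (x, φ x)) h.fst_eq
      rw [det_val, ← this, Measure.map_map hg measurable_fst]
      congr 1
      ext p <;> simp
    · rw [Measure.map_map (measurable_curve_eval 1) hF]
      congr 1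
      ext p <;> simp

/-! ### Couplings and `L²(γ)` -/

lemma memLp_two_iff {Ω : Type*} [MeasurableSpace Ω] {P : Measure Ω} {X : Ω → E d}
    (hX : Measurable X) : MemLp X 2 P ↔ ∫⁻ ω, ‖X ω‖ₑ ^ 2 ∂P < ∞ := by
  rw [MemLp, and_iff_right hX.aestronglyMeasurable,
    eLpNorm_lt_top_iff_lintegral_rpow_enorm_lt_top (by norm_num) (by norm_num)]
  simp

lemma memLp_id (μ : P2 d) : MemLp (fun x : E d => x) 2 μ.1 :=
  (memLp_two_iff measurable_id).2 μ.2.2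

namespace IsCoupling

lemma memLp_sub (h : IsCoupling μ ν γ) : MemLp (fun p : E d × E d => p.2 - p.1) 2 γ :=
  ((memLp_id ν).comp_measurePreserving h.mpSnd).sub
    ((memLp_id μ).comp_measurePreserving h.mpFst)

/-- The displacement `y - x`, as an element of `L²(γ)`. -/
def disp (h : IsCoupling μ ν γ) : Lp (E d) 2 γ := h.memLp_sub.toLp

/-- The isometry `φ ↦ φ(x)` from `L²(μ)` to `L²(γ)`. -/
def pullFst (h : IsCoupling μ ν γ) : L2 μ →ₗᵢ[ℝ] Lp (E d) 2 γ :=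
  Lp.compMeasurePreservingₗᵢ ℝ Prod.fst h.mpFst

/-- The isometry `φ ↦ φ(y)` from `L²(ν)` to `L²(γ)`. -/
def pullSnd (h : IsCoupling μ ν γ) : L2 ν →ₗᵢ[ℝ] Lp (E d) 2 γ :=
  Lp.compMeasurePreservingₗᵢ ℝ Prod.snd h.mpSnd

lemma coeFn_disp (h : IsCoupling μ ν γ) : h.disp =ᵐ[γ] fun p => p.2 - p.1 :=
  h.memLp_sub.coeFn_toLp

lemma coeFn_pullFst (h : IsCoupling μ ν γ) (φ : L2 μ) : h.pullFst φ =ᵐ[γ] fun p => φ p.1 :=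
  Lp.coeFn_compMeasurePreserving φ h.mpFst

lemma coeFn_pullSnd (h : IsCoupling μ ν γ) (φ : L2 ν) : h.pullSnd φ =ᵐ[γ] fun p => φ p.2 :=
  Lp.coeFn_compMeasurePreserving φ h.mpSnd

lemma C2_eq (h : IsCoupling μ ν γ) : C2 γ = ‖h.disp‖ := by
  rw [C2, ← Real.sqrt_sq (norm_nonneg h.disp), ← real_inner_self_eq_norm_sq, L2.inner_def]
  congr 1
  refine integral_congr_ae ?_
  filter_upwards [h.coeFn_disp] with p hp
  rw [hp, real_inner_self_eq_norm_sq, norm_sub_rev]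

lemma integral_inner_fst (h : IsCoupling μ ν γ) (φ : L2 μ) :
    ∫ p, inner ℝ (p.2 - p.1) (φ p.1) ∂γ = inner ℝ h.disp (h.pullFst φ) := by
  rw [L2.inner_def]
  refine integral_congr_ae ?_
  filter_upwards [h.coeFn_disp, h.coeFn_pullFst φ] with p hp hp'
  rw [hp, hp']

lemma integral_inner_snd (h : IsCoupling μ ν γ) (φ : L2 ν) :
    ∫ p, inner ℝ (p.2 - p.1) (φ p.2) ∂γ = inner ℝ h.disp (h.pullSnd φ) := by
  rw [L2.inner_def]
  refine integral_congr_ae ?_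
  filter_upwards [h.coeFn_disp, h.coeFn_pullSnd φ] with p hp hp'
  rw [hp, hp']

lemma dTan_transported (h : IsCoupling μ ν γ) {φ : L2 μ} {ψ : Tan ν}
    (hψ : IsTransported γ (det φ) ψ) (φ' : L2 ν) :
    dTan ψ (det φ') = ‖h.pullFst φ - h.pullSnd φ'‖ₑ := by
  have hφ := measurable_coe_L2 φ
  have hφ' := measurable_coe_L2 φ'
  rw [dTan_det, hψ.eq_map, eLpNorm_map_measure (by fun_prop) (by fun_prop), Lp.enorm_def]
  refine eLpNorm_congr_ae ?_
  filter_upwards [Lp.coeFn_sub (h.pullFst φ) (h.pullSnd φ'), h.coeFn_pullFst φ,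
    h.coeFn_pullSnd φ'] with p h1 h2 h3
  rw [h1, Pi.sub_apply, h2, h3]
  rfl

end IsCoupling

/-! ### The seminorm `Iα` as a Hölder constant in `L²(γ)` -/

lemma C2_nonneg (γ : Measure (E d × E d)) : 0 ≤ C2 γ := Real.sqrt_nonneg _

/-- This removes transports from the rest of the argument: at least one exists for each coupling,
and all of them give the same distance. -/
lemma Iα_le_ofReal_iff {α K : ℝ} (hK : 0 ≤ K) {Φ : ∀ μ : P2 d, L2 μ} :
    Iα α Φ ≤ ENNReal.ofReal K ↔
      ∀ (μ ν : P2 d) (γ : Measure (E d × E d)) (h : IsCoupling μ ν γ), 0 < C2 γ →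
        (α < 1 → C2 γ ≤ 1) → ‖h.pullFst (Φ μ) - h.pullSnd (Φ ν)‖ ≤ K * C2 γ ^ α := by
  have key : ∀ {μ ν : P2 d} {γ : Measure (E d × E d)} (h : IsCoupling μ ν γ), 0 < C2 γ →
      (‖h.pullFst (Φ μ) - h.pullSnd (Φ ν)‖ₑ / ENNReal.ofReal (C2 γ ^ α) ≤ ENNReal.ofReal K ↔
        ‖h.pullFst (Φ μ) - h.pullSnd (Φ ν)‖ ≤ K * C2 γ ^ α) := by
    intro μ ν γ h h0
    have hpos : 0 < C2 γ ^ α := Real.rpow_pos_of_pos h0 α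
    rw [ENNReal.div_le_iff (by simpa using hpos) ENNReal.ofReal_ne_top,
      ← ENNReal.ofReal_mul hK, ← ofReal_norm, ENNReal.ofReal_le_ofReal_iff (by positivity)]
  simp only [Iα, iSup_le_iff]
  constructor
  · intro H μ ν γ h h0 h1
    obtain ⟨ψ, hψ⟩ := h.exists_isTransported (Φ μ)
    have := H μ ν γ ⟨h, h0, h1⟩ ψ hψ
    rwa [h.dTan_transported hψ, key h h0] at this
  · rintro H μ ν γ ⟨h, h0, h1⟩ ψ hψ
    rw [h.dTan_transported hψ, key h h0]
    exact H μ ν γ h h0 h1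

lemma norm_defect_le {α : ℝ} {Φ : ∀ μ : P2 d, L2 μ} (hΦ : Iα α Φ < ∞)
    (h : IsCoupling μ ν γ) (h0 : 0 < C2 γ) (h1 : α < 1 → C2 γ ≤ 1) :
    ‖h.pullFst (Φ μ) - h.pullSnd (Φ ν)‖ ≤ (Iα α Φ).toReal * C2 γ ^ α :=
  (Iα_le_ofReal_iff ENNReal.toReal_nonneg).1 (ENNReal.ofReal_toReal hΦ.ne).ge μ ν γ h h0 h1

/-! ### Constructing couplings -/

section Law

variable {Ω : Type*} [MeasurableSpace Ω] {P : Measure Ω}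

/-- The law of a square integrable random vector. -/
def law (P : Measure Ω) [IsProbabilityMeasure P] (X : Ω → E d) (hX : Measurable X)
    (hX2 : MemLp X 2 P) : P2 d :=
  ⟨P.map X, Measure.isProbabilityMeasure_map hX.aemeasurable, by
    rw [lintegral_map (by fun_prop) hX]
    exact (memLp_two_iff hX).1 hX2⟩

lemma isCoupling_law [IsProbabilityMeasure P] {X Y : Ω → E d} (hX : Measurable X) (hX2 : MemLp X 2 P)
    (hY : Measurable Y) (hY2 : MemLp Y 2 P) :
    IsCoupling (law P X hX hX2) (law P Y hY hY2) (P.map fun ω => (X ω, Y ω)) where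
  isProb := Measure.isProbabilityMeasure_map (by fun_prop)
  fst_eq := by rw [Measure.map_map measurable_fst (by fun_prop)]; rfl
  snd_eq := by rw [Measure.map_map measurable_snd (by fun_prop)]; rfl

lemma C2_map {X Y : Ω → E d} (hX : Measurable X) (hY : Measurable Y) :
    C2 (P.map fun ω => (X ω, Y ω)) = Real.sqrt (∫ ω, ‖X ω - Y ω‖ ^ 2 ∂P) := by
  rw [C2, integral_map (by fun_prop) (by fun_prop)]

end Law

/-- Pushing `μ` along `x ↦ x + ξ(x)` gives a coupling with displacement `ξ`. -/
lemma exists_coupling_of_displacement (μ : P2 d) (ξ : L2 μ) :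
    ∃ (ν : P2 d) (γ : Measure (E d × E d)), IsCoupling μ ν γ ∧ C2 γ = ‖ξ‖ ∧
      ∀ φ : L2 μ, ∫ p, inner ℝ (p.2 - p.1) (φ p.1) ∂γ = inner ℝ ξ φ := by
  have hξ := measurable_coe_L2 ξ
  have hm : Measurable fun x => x + ξ x := by fun_prop
  have h := isCoupling_law (P := μ.1) measurable_id (memLp_id μ) hm
    ((memLp_id μ).add (Lp.memLp ξ))
  have hμ : law μ.1 (fun x => x) measurable_id (memLp_id μ) = μ := Subtype.ext Measure.map_id
  refine ⟨_, _, hμ ▸ h, ?_, fun φ => ?_⟩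
  · rw [C2_map measurable_id hm, ← Real.sqrt_sq (norm_nonneg ξ), ← real_inner_self_eq_norm_sq,
      L2.inner_def]
    simp
  · have hφ := measurable_coe_L2 φ
    rw [integral_map (by fun_prop)
      (by exact Measurable.aestronglyMeasurable (by fun_prop)), L2.inner_def]
    simp

/-! ### The derivative -/

lemma IsModulus.tendsto {ω : ℝ → ℝ} (hω : IsModulus ω) : Tendsto ω (𝓝[≥] 0) (𝓝 0) := by
  simpa [hω.zero] using hω.cont.tendsto

lemma IsModulus.nonneg {ω : ℝ → ℝ} (hω : IsModulus ω) {r : ℝ} (hr : 0 ≤ r) : 0 ≤ ω r :=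
  hω.zero ▸ hω.mono self_mem_Ici hr hr

lemma IsModulus.add {ω ω' : ℝ → ℝ} (hω : IsModulus ω) (hω' : IsModulus ω') :
    IsModulus fun r => ω r + ω' r where
  mono := hω.mono.add hω'.mono
  zero := by simp [hω.zero, hω'.zero]
  cont := hω.cont.add hω'.cont

lemma IsModulus.const_mul {ω : ℝ → ℝ} (hω : IsModulus ω) {c : ℝ} (hc : 0 ≤ c) :
    IsModulus fun r => c * ω r where
  mono := fun _ hx _ hy hxy => mul_le_mul_of_nonneg_left (hω.mono hx hy hxy) hc
  zero := by simp [hω.zero]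
  cont := continuousWithinAt_const.mul hω.cont

lemma HasGrad.add {U V : P2 d → ℝ} {φ φ' : L2 μ} (hU : HasGrad U μ φ) (hV : HasGrad V μ φ') :
    HasGrad (U + V) μ (φ + φ') := by
  obtain ⟨ω, hω, hU⟩ := hU
  obtain ⟨ω', hω', hV⟩ := hV
  refine ⟨_, hω.add hω', fun ν γ h => ?_⟩
  have h1 := hU ν γ h
  have h2 := hV ν γ h
  rw [h.integral_inner_fst] at *
  rw [map_add, inner_add_right]
  calc _ = |(U ν - U μ - inner ℝ h.disp (h.pullFst φ)) +
        (V ν - V μ - inner ℝ h.disp (h.pullFst φ'))| := by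
          simp only [Pi.add_apply]; congr 1; ring
    _ ≤ _ := (abs_add_le _ _).trans (by rw [mul_add]; exact add_le_add h1 h2)

lemma HasGrad.const_smul {U : P2 d → ℝ} {φ : L2 μ} (hU : HasGrad U μ φ) (c : ℝ) :
    HasGrad (c • U) μ (c • φ) := by
  obtain ⟨ω, hω, hU⟩ := hU
  refine ⟨_, hω.const_mul (abs_nonneg c), fun ν γ h => ?_⟩
  have h1 := hU ν γ h
  rw [h.integral_inner_fst] at *
  rw [map_smul, inner_smul_right]
  calc _ = |c| * |U ν - U μ - inner ℝ h.disp (h.pullFst φ)| := by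
          rw [← abs_mul]; simp only [Pi.smul_apply, smul_eq_mul]; congr 1; ring
    _ ≤ |c| * (C2 γ * ω (C2 γ)) := mul_le_mul_of_nonneg_left h1 (abs_nonneg c)
    _ = _ := by ring

lemma hasGrad_zero (μ : P2 d) : HasGrad (0 : P2 d → ℝ) μ 0 := by
  refine ⟨fun _ => 0, ⟨monotoneOn_const, rfl, continuousWithinAt_const⟩, fun ν γ h => ?_⟩
  rw [h.integral_inner_fst]
  simp

/-- The difference `ξ` of two gradients is a gradient of `0`. Tested on the displacement `t • ξ`,
this gives `‖ξ‖ ≤ ω (t * ‖ξ‖)`, which tends to `0` with `t`. -/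
lemma HasGrad.unique {U : P2 d → ℝ} {φ φ' : L2 μ} (h : HasGrad U μ φ) (h' : HasGrad U μ φ') :
    φ = φ' := by
  have h0 : HasGrad (0 : P2 d → ℝ) μ (φ - φ') := by
    have := h.add (h'.const_smul (-1))
    simpa [sub_eq_add_neg] using this
  obtain ⟨ω, hω, H⟩ := h0
  rw [← sub_eq_zero]
  set ξ := φ - φ'
  by_contra hξ
  have hpos : 0 < ‖ξ‖ := norm_pos_iff.2 hξ
  have hle : ∀ t : ℝ, 0 < t → ‖ξ‖ ≤ ω (t * ‖ξ‖) := by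
    intro t ht
    obtain ⟨ν, γ, hγ, hC, hint⟩ := exists_coupling_of_displacement μ (t • ξ)
    have := H ν γ hγ
    rw [hint, hC, norm_smul, Real.norm_of_nonneg ht.le, inner_smul_left,
      real_inner_self_eq_norm_sq] at this
    simp only [Pi.zero_apply, sub_zero, zero_sub, abs_neg, conj_trivial] at this
    rw [abs_of_nonneg (by positivity)] at this
    refine le_of_mul_le_mul_left ?_ (mul_pos ht hpos)
    linarith
  have ht : Tendsto (fun t : ℝ => ω (t * ‖ξ‖)) (𝓝[>] 0) (𝓝 0) := by
    refine hω.tendsto.comp (tendsto_nhdsWithin_iff.2 ⟨?_, ?_⟩)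
    · have : Tendsto (fun t : ℝ => t * ‖ξ‖) (𝓝 0) (𝓝 (0 * ‖ξ‖)) :=
        tendsto_id.mul_const _
      rw [zero_mul] at this
      exact this.mono_left nhdsWithin_le_nhds
    · filter_upwards [self_mem_nhdsWithin] with t ht
      exact mul_nonneg (le_of_lt ht) hpos.le
  have := ge_of_tendsto ht (by filter_upwards [self_mem_nhdsWithin] with t ht using hle t ht)
  exact absurd this (not_le.2 hpos)

lemma HasGrad.grad_eq {U : P2 d → ℝ} {φ : L2 μ} (h : HasGrad U μ φ) : grad U μ = φ := by
  have hex : ∃ φ : L2 μ, HasGrad U μ φ := ⟨φ, h⟩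
  rw [grad, dif_pos hex]
  exact hex.choose_spec.unique h

lemma IsC1α.hasGrad {α : ℝ} {U : P2 d → ℝ} (hU : IsC1α α U) (μ : P2 d) :
    HasGrad U μ (grad U μ) := by
  obtain ⟨φ, hφ⟩ := hU.differentiable μ
  rwa [hφ.grad_eq]

/-! ### Displacement interpolation and the first-order Taylor estimate -/

/-- The point at time `t` on the line from `x` to `y`. -/
def interp (t : ℝ) (p : E d × E d) : E d := p.1 + t • (p.2 - p.1)

@[fun_prop]
lemma measurable_interp (t : ℝ) : Measurable (interp (d := d) t) := by
  unfold interp; fun_prop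

lemma interp_sub_interp (s t : ℝ) (p : E d × E d) :
    interp t p - interp s p = (t - s) • (p.2 - p.1) := by
  simp only [interp, add_sub_add_left_eq_sub, sub_smul]

namespace IsCoupling

lemma memLp_interp (h : IsCoupling μ ν γ) (t : ℝ) : MemLp (interp t) 2 γ :=
  ((memLp_id μ).comp_measurePreserving h.mpFst).add (h.memLp_sub.const_smul t)

/-- The displacement interpolation from `μ` to `ν` along the coupling `γ`. -/
def interpLaw (h : IsCoupling μ ν γ) (t : ℝ) : P2 d :=
  have := h.isProb
  law γ (interp t) (measurable_interp t) (h.memLp_interp t)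

lemma interpLaw_zero (h : IsCoupling μ ν γ) : h.interpLaw 0 = μ := by
  refine Subtype.ext (Eq.trans ?_ h.fst_eq)
  change γ.map (interp 0) = _
  congr 1
  ext1 p
  simp [interp]

lemma interpLaw_one (h : IsCoupling μ ν γ) : h.interpLaw 1 = ν := by
  refine Subtype.ext (Eq.trans ?_ h.snd_eq)
  change γ.map (interp 1) = _
  congr 1
  ext1 p
  simp [interp]

lemma isCoupling_interpLaw (h : IsCoupling μ ν γ) (s t : ℝ) :
    IsCoupling (h.interpLaw s) (h.interpLaw t) (γ.map fun p => (interp s p, interp t p)) :=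
  have := h.isProb
  isCoupling_law (measurable_interp s) (h.memLp_interp s) (measurable_interp t) (h.memLp_interp t)

end IsCoupling

lemma C2_map_interp (γ : Measure (E d × E d)) (s t : ℝ) :
    C2 (γ.map fun p => (interp s p, interp t p)) = |t - s| * C2 γ := by
  rw [C2_map (measurable_interp s) (measurable_interp t), C2]
  have : ∀ p : E d × E d, ‖interp s p - interp t p‖ ^ 2 = |t - s| ^ 2 * ‖p.1 - p.2‖ ^ 2 := by
    intro p
    rw [← norm_neg, neg_sub, interp_sub_interp, norm_smul, norm_sub_rev p.1, mul_pow,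
      Real.norm_eq_abs]
  simp only [this, integral_const_mul]
  rw [Real.sqrt_mul (by positivity), Real.sqrt_sq (abs_nonneg _)]

lemma integral_map_interp {f : E d → E d} (hf : Measurable f) (γ : Measure (E d × E d))
    (s t : ℝ) :
    ∫ q, inner ℝ (q.2 - q.1) (f q.1) ∂(γ.map fun p => (interp s p, interp t p)) =
      (t - s) * ∫ p, inner ℝ (p.2 - p.1) (f (interp s p)) ∂γ := by
  rw [integral_map (by fun_prop) (by exact Measurable.aestronglyMeasurable (by fun_prop)),
    ← integral_const_mul]
  simp only [interp_sub_interp, real_inner_smul_left]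

lemma integral_map_interp_snd {f : E d → E d} (hf : Measurable f) (γ : Measure (E d × E d))
    (s t : ℝ) :
    ∫ q, inner ℝ (q.2 - q.1) (f q.2) ∂(γ.map fun p => (interp s p, interp t p)) =
      (t - s) * ∫ p, inner ℝ (p.2 - p.1) (f (interp t p)) ∂γ := by
  rw [integral_map (by fun_prop) (by exact Measurable.aestronglyMeasurable (by fun_prop)),
    ← integral_const_mul]
  simp only [interp_sub_interp, real_inner_smul_left]

/-- Here `c` stands for `C2 γ`: the interpolations at times `s` and `t` are coupled at distance `|s
- t| * C2 γ`. -/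
lemma hasDerivAt_of_modulus {f : ℝ → ℝ} {f' t c : ℝ} {ω : ℝ → ℝ} (hω : IsModulus ω)
    (hc : 0 ≤ c)
    (hf : ∀ s, |f s - f t - (s - t) * f'| ≤ |s - t| * c * ω (|s - t| * c)) :
    HasDerivAt f f' t := by
  rw [hasDerivAt_iff_isLittleO]
  have hlim : Tendsto (fun s => c * ω (|s - t| * c)) (𝓝 t) (𝓝 0) := by
    rw [← mul_zero c]
    refine (hω.tendsto.comp (tendsto_nhdsWithin_iff.2 ⟨?_, ?_⟩)).const_mul c
    · have : Continuous fun s => |s - t| * c := by fun_prop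
      simpa using this.tendsto t
    · exact Eventually.of_forall fun s => mul_nonneg (abs_nonneg _) hc
  have hO : (fun s => f s - f t - (s - t) • f') =O[𝓝 t]
      fun s => (c * ω (|s - t| * c)) * (s - t) := by
    refine Asymptotics.IsBigO.of_bound 1 (Eventually.of_forall fun s => ?_)
    rw [smul_eq_mul, one_mul, norm_mul, Real.norm_eq_abs, Real.norm_eq_abs, Real.norm_eq_abs,
      abs_of_nonneg (mul_nonneg hc (hω.nonneg (mul_nonneg (abs_nonneg _) hc)))]
    exact (hf s).trans_eq (by ring)
  refine hO.trans_isLittleO ?_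
  simpa using ((Asymptotics.isLittleO_one_iff ℝ).2 hlim).mul_isBigO
    (Asymptotics.isBigO_refl (fun s => s - t) (𝓝 t))

section Taylor

variable {α : ℝ} {U : P2 d → ℝ}

/-- The derivative at time `t` of `U` along the interpolation. -/
def lineDeriv' (U : P2 d → ℝ) (h : IsCoupling μ ν γ) (t : ℝ) : ℝ :=
  ∫ p, inner ℝ (p.2 - p.1) (grad U (h.interpLaw t) (interp t p)) ∂γ

lemma IsC1α.hasDerivAt_interpLaw (hU : IsC1α α U) (h : IsCoupling μ ν γ) (t : ℝ) :
    HasDerivAt (fun s => U (h.interpLaw s)) (lineDeriv' U h t) t := by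
  obtain ⟨ω, hω, H⟩ := hU.hasGrad (h.interpLaw t)
  refine hasDerivAt_of_modulus hω (C2_nonneg γ) fun s => ?_
  have := H _ _ (h.isCoupling_interpLaw t s)
  rwa [C2_map_interp, integral_map_interp (measurable_coe_L2 _)] at this

lemma lineDeriv'_zero (h : IsCoupling μ ν γ) :
    lineDeriv' U h 0 = inner ℝ h.disp (h.pullFst (grad U μ)) := by
  -- The two gradients lie in `L²` spaces of measures that are only propositionally equal, so they
  -- are compared as plain functions.
  have h0 : (fun x => grad U (h.interpLaw 0) x) = fun x => grad U μ x := by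
    rw [h.interpLaw_zero]
  rw [← h.integral_inner_fst, lineDeriv']
  refine integral_congr_ae (ae_of_all _ fun p => ?_)
  have := congrFun h0 p.1
  simp [interp, this]

/-- The coupling of the interpolations at times `0` and `t` has displacement `t • (y - x)`. Pairing
it with the difference of the gradients at its two ends gives `t` times the left side;
Cauchy–Schwarz and the Hölder bound estimate it, and `t` cancels. -/
lemma IsC1α.abs_lineDeriv'_sub_le (hα : 0 < α) (hU : IsC1α α U) (h : IsCoupling μ ν γ)
    (h1 : C2 γ ≤ 1) {t : ℝ} (ht : t ∈ Icc (0 : ℝ) 1) :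
    |lineDeriv' U h t - lineDeriv' U h 0| ≤ (Iα α (grad U)).toReal * C2 γ ^ α * C2 γ := by
  have hC := C2_nonneg γ
  have hI : 0 ≤ (Iα α (grad U)).toReal := ENNReal.toReal_nonneg
  -- `Iα` says nothing about couplings with `C2 γ = 0`; there the displacement vanishes, and so does
  -- the derivative. The case `t = 0` is split off for the same reason.
  rcases hC.eq_or_lt with h0 | hpos
  · have hz : ∀ t, lineDeriv' U h t = 0 := by
      intro t
      have hd : h.disp = 0 := norm_eq_zero.1 (h.C2_eq ▸ h0.symm)
      have hae : ∀ᵐ p ∂γ, p.2 - p.1 = 0 := by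
        filter_upwards [h.coeFn_disp, Lp.coeFn_zero (E d) 2 γ] with p hp hp0
        rw [← hp, hd, hp0]; rfl
      rw [lineDeriv', ← integral_zero (E d × E d) ℝ]
      refine integral_congr_ae ?_
      filter_upwards [hae] with p hp
      rw [hp, inner_zero_left]
    rw [hz, hz, sub_self, abs_zero]
    positivity
  rcases ht.1.eq_or_lt with rfl | ht0
  · rw [sub_self, abs_zero]
    positivity
  have hcp := h.isCoupling_interpLaw 0 t
  have hC2 : C2 (γ.map fun p => (interp 0 p, interp t p)) = t * C2 γ := by
    rw [C2_map_interp, sub_zero, abs_of_pos ht0]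
  have htC : t * C2 γ ≤ C2 γ := mul_le_of_le_one_left hC ht.2
  have hdef := norm_defect_le hU.finite hcp (by rw [hC2]; positivity)
    (fun _ => by rw [hC2]; exact htC.trans h1)
  rw [hC2] at hdef
  have heq : t * (lineDeriv' U h t - lineDeriv' U h 0) =
      inner ℝ hcp.disp (hcp.pullSnd (grad U (h.interpLaw t)) -
        hcp.pullFst (grad U (h.interpLaw 0))) := by
    rw [inner_sub_right, ← hcp.integral_inner_fst, ← hcp.integral_inner_snd,
      integral_map_interp (measurable_coe_L2 _), integral_map_interp_snd (measurable_coe_L2 _)]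
    simp only [lineDeriv', sub_zero]
    ring
  have hle := abs_real_inner_le_norm hcp.disp (hcp.pullSnd (grad U (h.interpLaw t)) -
        hcp.pullFst (grad U (h.interpLaw 0)))
  rw [← heq, ← hcp.C2_eq, hC2, abs_mul, abs_of_pos ht0, norm_sub_rev, mul_assoc] at hle
  refine (le_of_mul_le_mul_left hle ht0).trans ?_
  rw [mul_comm]
  refine mul_le_mul_of_nonneg_right (hdef.trans ?_) hC
  exact mul_le_mul_of_nonneg_left (Real.rpow_le_rpow (by positivity) htC hα.le) hI

/-- First-order Taylor estimate for functions of class `C^{1,α}`. -/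
lemma IsC1α.taylor (hα : 0 < α) (hU : IsC1α α U) (h : IsCoupling μ ν γ) (h1 : C2 γ ≤ 1) :
    |U ν - U μ - inner ℝ h.disp (h.pullFst (grad U μ))| ≤
      (Iα α (grad U)).toReal * C2 γ ^ α * C2 γ := by
  have hd : ∀ t ∈ Icc (0 : ℝ) 1, HasDerivWithinAt
      (fun s => U (h.interpLaw s) - s * lineDeriv' U h 0)
      (lineDeriv' U h t - lineDeriv' U h 0) (Icc 0 1) t := fun t _ => by
    simpa using ((hU.hasDerivAt_interpLaw h t).fun_sub
      ((hasDerivAt_id t).mul_const (lineDeriv' U h 0))).hasDerivWithinAt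
  have := norm_image_sub_le_of_norm_deriv_le_segment_01' hd
    fun t ht => hU.abs_lineDeriv'_sub_le hα h h1 (Ico_subset_Icc_self ht)
  rw [h.interpLaw_zero, h.interpLaw_one, lineDeriv'_zero, Real.norm_eq_abs] at this
  convert this using 2
  ring

/-- A bounded function of class `C^{1,α}` has a bounded derivative. -/
lemma IsC1α.norm_grad_le (hα : 0 < α) (hU : IsC1α α U) {C : ℝ} (hC : ∀ μ, |U μ| ≤ C)
    (μ : P2 d) : ‖grad U μ‖ ≤ 2 * C + (Iα α (grad U)).toReal := by
  have hI : 0 ≤ (Iα α (grad U)).toReal := ENNReal.toReal_nonneg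
  have hC0 : 0 ≤ C := (abs_nonneg _).trans (hC μ)
  rcases eq_or_ne (grad U μ) 0 with h0 | h0
  · rw [h0, norm_zero]
    positivity
  have hn : ‖grad U μ‖ ≠ 0 := norm_ne_zero_iff.2 h0
  -- A displacement of norm `1`, the longest that `taylor` allows, whose pairing with the gradient
  -- is the norm of the gradient.
  obtain ⟨ν, γ, h, hγ, hint⟩ := exists_coupling_of_displacement μ (‖grad U μ‖⁻¹ • grad U μ)
  rw [norm_smul, norm_inv, norm_norm, inv_mul_cancel₀ hn] at hγ
  have hT := hU.taylor hα h hγ.le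
  rw [← h.integral_inner_fst, hint, real_inner_smul_left, real_inner_self_eq_norm_sq, hγ,
    Real.one_rpow, sq, inv_mul_cancel_left₀ hn] at hT
  have h1 := abs_le.1 hT
  have h2 := abs_le.1 (hC μ)
  have h3 := abs_le.1 (hC ν)
  linarith [h1.1, h2.1, h3.2]

end Taylor

variable {α : ℝ} {U V : P2 d → ℝ}

/-! ### The vector space structure and the norm -/

lemma N_eq (α : ℝ) (U : P2 d → ℝ) :
    N α U = (⨆ μ, ‖U μ‖ₑ) + (⨆ μ, ‖grad U μ‖ₑ) + Iα α (grad U) := by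
  simp only [N, dTan_det_zero]

lemma Iα_le_N (α : ℝ) (U : P2 d → ℝ) : Iα α (grad U) ≤ N α U := le_add_self

lemma abs_le_N (hN : N α U < ∞) (μ : P2 d) : |U μ| ≤ (N α U).toReal := by
  have h : ‖U μ‖ₑ ≤ N α U := by
    rw [N_eq, add_assoc]
    exact (le_iSup (fun μ => ‖U μ‖ₑ) μ).trans le_self_add
  simpa using ENNReal.toReal_mono hN.ne h

lemma norm_grad_le_N (hN : N α U < ∞) (μ : P2 d) : ‖grad U μ‖ ≤ (N α U).toReal := by
  have h : ‖grad U μ‖ₑ ≤ N α U := by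
    rw [N_eq, add_right_comm]
    exact (le_iSup (fun μ => ‖grad U μ‖ₑ) μ).trans le_add_self
  simpa using ENNReal.toReal_mono hN.ne h

lemma norm_defect_le_N (hN : N α U < ∞) (h : IsCoupling μ ν γ) (h0 : 0 < C2 γ)
    (h1 : α < 1 → C2 γ ≤ 1) :
    ‖h.pullFst (grad U μ) - h.pullSnd (grad U ν)‖ ≤ (N α U).toReal * C2 γ ^ α :=
  (norm_defect_le ((Iα_le_N α U).trans_lt hN) h h0 h1).trans
    (mul_le_mul_of_nonneg_right (ENNReal.toReal_mono hN.ne (Iα_le_N α U))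
      (Real.rpow_nonneg h0.le α))

lemma N_le {a b c : ℝ} (ha : 0 ≤ a) (hb : 0 ≤ b) (hc : 0 ≤ c) (hU : ∀ μ, |U μ| ≤ a)
    (hgrad : ∀ μ, ‖grad U μ‖ ≤ b) (hI : Iα α (grad U) ≤ ENNReal.ofReal c) :
    N α U ≤ ENNReal.ofReal (a + b + c) := by
  rw [N_eq, ENNReal.ofReal_add (by positivity) hc, ENNReal.ofReal_add ha hb]
  refine add_le_add (add_le_add (iSup_le fun μ => ?_) (iSup_le fun μ => ?_)) hI
  · rw [← ofReal_norm]
    exact ENNReal.ofReal_le_ofReal (hU μ)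
  · rw [← ofReal_norm]
    exact ENNReal.ofReal_le_ofReal (hgrad μ)

lemma IsC1α.N_lt_top (hα : 0 < α) (hU : IsC1α α U) (hb : IsBdd U) : N α U < ∞ := by
  obtain ⟨C, hC⟩ := hb
  have hC' : ∀ μ, |U μ| ≤ |C| := fun μ => (hC μ).trans (le_abs_self C)
  have hI : 0 ≤ (Iα α (grad U)).toReal := ENNReal.toReal_nonneg
  exact (N_le (abs_nonneg C) (by positivity) hI hC' (fun μ => hU.norm_grad_le hα hC' μ)
    (ENNReal.ofReal_toReal hU.finite.ne).ge).trans_lt ENNReal.ofReal_lt_top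

lemma Iα_add_le {Φ Φ' : ∀ μ : P2 d, L2 μ} (h : Iα α Φ < ∞) (h' : Iα α Φ' < ∞) :
    Iα α (Φ + Φ') ≤ Iα α Φ + Iα α Φ' := by
  have hn := ENNReal.toReal_nonneg (a := Iα α Φ)
  have hn' := ENNReal.toReal_nonneg (a := Iα α Φ')
  rw [← ENNReal.ofReal_toReal h.ne, ← ENNReal.ofReal_toReal h'.ne, ← ENNReal.ofReal_add hn hn',
    Iα_le_ofReal_iff (by positivity)]
  intro μ ν γ hγ h0 h1
  simp only [Pi.add_apply, map_add]
  rw [add_sub_add_comm, add_mul]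
  exact (norm_add_le _ _).trans
    (add_le_add (norm_defect_le h hγ h0 h1) (norm_defect_le h' hγ h0 h1))

lemma Iα_smul_le {Φ : ∀ μ : P2 d, L2 μ} (c : ℝ) (h : Iα α Φ < ∞) :
    Iα α (c • Φ) ≤ ‖c‖ₑ * Iα α Φ := by
  have hn := ENNReal.toReal_nonneg (a := Iα α Φ)
  rw [← ENNReal.ofReal_toReal h.ne, ← ofReal_norm, ← ENNReal.ofReal_mul (norm_nonneg c),
    Iα_le_ofReal_iff (by positivity)]
  intro μ ν γ hγ h0 h1
  simp only [Pi.smul_apply, map_smul]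
  rw [← smul_sub, norm_smul, mul_assoc]
  exact mul_le_mul_of_nonneg_left (norm_defect_le h hγ h0 h1) (norm_nonneg c)

lemma grad_zero : grad (0 : P2 d → ℝ) = 0 :=
  funext fun μ => (hasGrad_zero μ).grad_eq

lemma IsC1α.grad_add (hU : IsC1α α U) (hV : IsC1α α V) : grad (U + V) = grad U + grad V :=
  funext fun μ => ((hU.hasGrad μ).add (hV.hasGrad μ)).grad_eq

lemma IsC1α.grad_smul (hU : IsC1α α U) (c : ℝ) : grad (c • U) = c • grad U :=
  funext fun μ => ((hU.hasGrad μ).const_smul c).grad_eq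

lemma isC1α_zero (α : ℝ) : IsC1α α (0 : P2 d → ℝ) where
  differentiable μ := ⟨0, hasGrad_zero μ⟩
  finite := by
    refine lt_of_le_of_lt ?_ (ENNReal.ofReal_lt_top (r := 0))
    rw [Iα_le_ofReal_iff le_rfl, grad_zero]
    intro μ ν γ h _ _
    simp

lemma IsC1α.add (hU : IsC1α α U) (hV : IsC1α α V) : IsC1α α (U + V) where
  differentiable μ := ⟨_, (hU.hasGrad μ).add (hV.hasGrad μ)⟩
  finite := by
    rw [hU.grad_add hV]
    exact (Iα_add_le hU.finite hV.finite).trans_lt (ENNReal.add_lt_top.2 ⟨hU.finite, hV.finite⟩)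

lemma IsC1α.smul (hU : IsC1α α U) (c : ℝ) : IsC1α α (c • U) where
  differentiable μ := ⟨_, (hU.hasGrad μ).const_smul c⟩
  finite := by
    rw [hU.grad_smul c]
    exact (Iα_smul_le c hU.finite).trans_lt (ENNReal.mul_lt_top enorm_lt_top hU.finite)

/-- The space of bounded functions of class `C^{1,α}`. -/
def boundedC1α (d : ℕ) (α : ℝ) : Submodule ℝ (P2 d → ℝ) where
  carrier := {U | IsC1α α U ∧ IsBdd U}
  zero_mem' := ⟨isC1α_zero α, 0, fun μ => by simp⟩
  add_mem' := by
    rintro U V ⟨hU, C, hC⟩ ⟨hV, C', hC'⟩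
    exact ⟨hU.add hV, C + C', fun μ => (abs_add_le _ _).trans (add_le_add (hC μ) (hC' μ))⟩
  smul_mem' := by
    rintro c U ⟨hU, C, hC⟩
    refine ⟨hU.smul c, |c| * C, fun μ => ?_⟩
    rw [Pi.smul_apply, smul_eq_mul, abs_mul]
    exact mul_le_mul_of_nonneg_left (hC μ) (abs_nonneg c)

lemma IsC1α.N_add_le (hU : IsC1α α U) (hV : IsC1α α V) : N α (U + V) ≤ N α U + N α V := by
  rw [N_eq, N_eq, N_eq, hU.grad_add hV]
  have h1 : (⨆ μ, ‖(U + V) μ‖ₑ) ≤ (⨆ μ, ‖U μ‖ₑ) + ⨆ μ, ‖V μ‖ₑ :=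
    iSup_le fun μ => (enorm_add_le _ _).trans
      (add_le_add (le_iSup (fun μ => ‖U μ‖ₑ) μ) (le_iSup (fun μ => ‖V μ‖ₑ) μ))
  have h2 : (⨆ μ, ‖(grad U + grad V) μ‖ₑ) ≤ (⨆ μ, ‖grad U μ‖ₑ) + ⨆ μ, ‖grad V μ‖ₑ :=
    iSup_le fun μ => (enorm_add_le _ _).trans
      (add_le_add (le_iSup (fun μ => ‖grad U μ‖ₑ) μ) (le_iSup (fun μ => ‖grad V μ‖ₑ) μ))
  refine (add_le_add (add_le_add h1 h2) (Iα_add_le hU.finite hV.finite)).trans_eq ?_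
  ring

lemma IsC1α.N_smul_le (hU : IsC1α α U) (c : ℝ) : N α (c • U) ≤ ‖c‖ₑ * N α U := by
  rw [N_eq, N_eq, hU.grad_smul c, mul_add, mul_add]
  refine add_le_add (add_le_add ?_ ?_) (Iα_smul_le c hU.finite)
  · refine iSup_le fun μ => ?_
    rw [Pi.smul_apply, enorm_smul]
    exact mul_le_mul_right (le_iSup (fun μ => ‖U μ‖ₑ) μ) _
  · refine iSup_le fun μ => ?_
    rw [Pi.smul_apply, enorm_smul]
    exact mul_le_mul_right (le_iSup (fun μ => ‖grad U μ‖ₑ) μ) _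

/-- The reverse inequality is `N_smul_le` for `c⁻¹` applied to `c • U`. -/
lemma IsC1α.toReal_N_smul (hα : 0 < α) (hU : IsC1α α U) (hb : IsBdd U) (c : ℝ) :
    (N α (c • U)).toReal = |c| * (N α U).toReal := by
  have hle : ∀ {V : P2 d → ℝ}, V ∈ boundedC1α d α → ∀ a : ℝ,
      (N α (a • V)).toReal ≤ |a| * (N α V).toReal := by
    intro V hV a
    have := ENNReal.toReal_mono
      (ENNReal.mul_ne_top enorm_ne_top (hV.1.N_lt_top hα hV.2).ne) (hV.1.N_smul_le a)
    simpa using this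
  have hmem : U ∈ boundedC1α d α := ⟨hU, hb⟩
  refine le_antisymm (hle hmem c) ?_
  rcases eq_or_ne c 0 with rfl | hc
  · simp
  · have := hle ((boundedC1α d α).smul_mem c hmem) c⁻¹
    rw [inv_smul_smul₀ hc, abs_inv, inv_mul_eq_div, le_div_iff₀' (abs_pos.2 hc)] at this
    exact this

lemma toReal_N_add_le (hα : 0 < α) (U V : boundedC1α d α) :
    (N α (U + V).1).toReal ≤ (N α U.1).toReal + (N α V.1).toReal := by
  have hU := (U.2.1.N_lt_top hα U.2.2).ne
  have hV := (V.2.1.N_lt_top hα V.2.2).ne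
  rw [← ENNReal.toReal_add hU hV]
  exact ENNReal.toReal_mono (ENNReal.add_ne_top.2 ⟨hU, hV⟩) (U.2.1.N_add_le V.2.1)

lemma normedSpaceCore (hα : 0 < α) :
    @NormedSpace.Core ℝ (boundedC1α d α) _ _ _ ⟨fun U => (N α U.1).toReal⟩ :=
  letI : Norm (boundedC1α d α) := ⟨fun U => (N α U.1).toReal⟩
  { norm_nonneg := fun _ => ENNReal.toReal_nonneg
    norm_smul := fun c U => U.2.1.toReal_N_smul hα U.2.2 c
    norm_triangle := toReal_N_add_le hα
    norm_eq_zero_iff := fun U => by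
      change (N α U.1).toReal = 0 ↔ U = 0
      constructor
      · intro h
        refine Subtype.ext (funext fun μ => ?_)
        -- Definiteness comes from the sup norm alone.
        have := abs_le_N (U.2.1.N_lt_top hα U.2.2) μ
        rw [h] at this
        exact abs_nonpos_iff.1 this
      · rintro rfl
        have := (isC1α_zero (d := d) α).toReal_N_smul hα ⟨0, fun μ => by simp⟩ 0
        rwa [zero_smul, abs_zero, zero_mul] at this }

/-! ### Completeness -/

/-- The modulus of continuity `r ↦ K r^α` for `r ≤ 1`, and `r ↦ K r^α + 3 K` for `r > 1`. -/
lemma isModulus_rpow_add_jump (hα : 0 < α) {K : ℝ} (hK : 0 ≤ K) :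
    IsModulus fun r => K * r ^ α + if r ≤ 1 then 0 else 3 * K where
  mono := by
    intro r hr s _ hrs
    refine add_le_add (mul_le_mul_of_nonneg_left (Real.rpow_le_rpow hr hrs hα.le) hK) ?_
    split_ifs <;> linarith
  zero := by simp [hα.ne']
  cont := by
    have hc : ContinuousAt (fun r : ℝ => K * r ^ α) 0 :=
      continuousAt_const.mul (Real.continuousAt_rpow_const 0 α (Or.inr hα.le))
    refine (hc.congr ?_).continuousWithinAt
    filter_upwards [Iio_mem_nhds (zero_lt_one' ℝ)] with r hr
    simp [le_of_lt (mem_Iio.1 hr)]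

/-- A uniform modulus of differentiability on bounded sets for `N`. -/
lemma IsC1α.abs_sub_sub_le (hα : 0 < α) (hU : IsC1α α U) {K : ℝ} (hN : N α U < ∞)
    (hK : (N α U).toReal ≤ K) (h : IsCoupling μ ν γ) :
    |U ν - U μ - inner ℝ h.disp (h.pullFst (grad U μ))| ≤
      C2 γ * (K * C2 γ ^ α + if C2 γ ≤ 1 then 0 else 3 * K) := by
  have hC := C2_nonneg γ
  have hI := ENNReal.toReal_mono hN.ne (Iα_le_N α U)
  have hK0 : 0 ≤ K := ENNReal.toReal_nonneg.trans hK
  have hCα := Real.rpow_nonneg hC α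
  split_ifs with h1
  · refine (hU.taylor hα h h1).trans ?_
    rw [add_zero, mul_comm (C2 γ)]
    gcongr
    exact hI.trans hK
  -- For `C2 γ > 1` the Taylor estimate is unavailable, but the two values and the pairing are each
  -- at most `K * C2 γ`, whence the jump `3 * K`.
  · have hν := (abs_le_N hN ν).trans hK
    have hμ := (abs_le_N hN μ).trans hK
    have hg := (norm_grad_le_N hN μ).trans hK
    have hin := abs_real_inner_le_norm h.disp (h.pullFst (grad U μ))
    rw [← h.C2_eq, LinearIsometry.norm_map] at hin
    calc _ ≤ |U ν| + |U μ| + |inner ℝ h.disp (h.pullFst (grad U μ))| :=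
          (abs_sub _ _).trans (add_le_add_left (abs_sub _ _) _)
      _ ≤ K + K + C2 γ * K := by gcongr; exact hin.trans (by gcongr)
      _ ≤ C2 γ * (0 + 3 * K) := by nlinarith [not_le.1 h1]
      _ ≤ _ := by gcongr; positivity

/-- Pointwise limits of functions and gradients inherit differentiability, if the norms are
bounded. -/
lemma hasGrad_of_tendsto (hα : 0 < α) {u : ℕ → P2 d → ℝ} (hu : ∀ n, IsC1α α (u n)) {K : ℝ}
    (hN : ∀ n, N α (u n) < ∞) (hK : ∀ᶠ n in atTop, (N α (u n)).toReal ≤ K)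
    (hU : ∀ μ, Tendsto (fun n => u n μ) atTop (𝓝 (U μ))) {φ : L2 μ}
    (hφ : Tendsto (fun n => grad (u n) μ) atTop (𝓝 φ)) : HasGrad U μ φ := by
  have hK0 : 0 ≤ K := by
    obtain ⟨n, hn⟩ := hK.exists
    exact ENNReal.toReal_nonneg.trans hn
  refine ⟨_, isModulus_rpow_add_jump hα hK0, fun ν γ h => ?_⟩
  rw [h.integral_inner_fst]
  have hlim : Tendsto (fun n => inner ℝ h.disp (h.pullFst (grad (u n) μ))) atTop
      (𝓝 (inner ℝ h.disp (h.pullFst φ))) :=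
    tendsto_const_nhds.inner ((h.pullFst.continuous.tendsto φ).comp hφ)
  refine le_of_tendsto (((hU ν).sub (hU μ)).sub hlim).abs ?_
  filter_upwards [hK] with n hn
  exact (hu n).abs_sub_sub_le hα (hN n) hn h

/-- If pointwise limits of functions and gradients are given, a bound on the norms passes to the
limit. -/
lemma N_le_of_tendsto {u : ℕ → P2 d → ℝ} {K : ℝ}
    (hN : ∀ n, N α (u n) < ∞) (hK : ∀ᶠ n in atTop, (N α (u n)).toReal ≤ K)
    (hU : ∀ μ, Tendsto (fun n => u n μ) atTop (𝓝 (U μ)))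
    (hgrad : ∀ μ, Tendsto (fun n => grad (u n) μ) atTop (𝓝 (grad U μ))) :
    N α U ≤ ENNReal.ofReal (3 * K) := by
  have hK0 : 0 ≤ K := by
    obtain ⟨n, hn⟩ := hK.exists
    exact ENNReal.toReal_nonneg.trans hn
  -- Each of the three terms of `N` is bounded by `K` separately. The lost factor `3` is harmless
  -- for completeness.
  rw [show 3 * K = K + K + K by ring]
  refine N_le hK0 hK0 hK0 (fun μ => ?_) (fun μ => ?_) ((Iα_le_ofReal_iff hK0).2 ?_)
  · refine le_of_tendsto (hU μ).abs ?_
    filter_upwards [hK] with n hn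
    exact (abs_le_N (hN n) μ).trans hn
  · refine le_of_tendsto (hgrad μ).norm ?_
    filter_upwards [hK] with n hn
    exact (norm_grad_le_N (hN n) μ).trans hn
  · intro μ ν γ h h0 h1
    refine le_of_tendsto ((((h.pullFst.continuous.tendsto _).comp (hgrad μ))).sub
      ((h.pullSnd.continuous.tendsto _).comp (hgrad ν))).norm ?_
    filter_upwards [hK] with n hn
    exact (norm_defect_le_N (hN n) h h0 h1).trans
      (mul_le_mul_of_nonneg_right hn (Real.rpow_nonneg h0.le α))

lemma IsC1α.grad_sub (hU : IsC1α α U) (hV : IsC1α α V) : grad (U - V) = grad U - grad V := by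
  rw [sub_eq_add_neg, ← neg_one_smul ℝ V, hU.grad_add (hV.smul (-1)), hV.grad_smul,
    neg_one_smul, sub_eq_add_neg]

lemma exists_tendsto_N (hα : 0 < α) (u : ℕ → boundedC1α d α)
    (hu : ∀ ε : ℝ, 0 < ε → ∃ n₀ : ℕ, ∀ m ≥ n₀, ∀ n ≥ n₀, (N α (u m - u n).1).toReal < ε) :
    ∃ U : boundedC1α d α, Tendsto (fun n => (N α (u n - U).1).toReal) atTop (𝓝 0) := by
  have hfin : ∀ V : boundedC1α d α, N α V.1 < ∞ := fun V => V.2.1.N_lt_top hα V.2.2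
  have hgsub : ∀ V W : boundedC1α d α, grad (V - W).1 = grad V.1 - grad W.1 :=
    fun V W => V.2.1.grad_sub W.2.1
  have hcauchy : ∀ μ, CauchySeq fun n => (u n).1 μ := by
    refine fun μ => Metric.cauchySeq_iff.2 fun ε hε => ?_
    obtain ⟨n₀, h⟩ := hu ε hε
    refine ⟨n₀, fun m hm n hn => ?_⟩
    rw [Real.dist_eq]
    exact (abs_le_N (hfin (u m - u n)) μ).trans_lt (h m hm n hn)
  have hcauchy' : ∀ μ, CauchySeq fun n => grad (u n).1 μ := by
    refine fun μ => Metric.cauchySeq_iff.2 fun ε hε => ?_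
    obtain ⟨n₀, h⟩ := hu ε hε
    refine ⟨n₀, fun m hm n hn => ?_⟩
    have := norm_grad_le_N (hfin (u m - u n)) μ
    rw [hgsub] at this
    rw [dist_eq_norm]
    exact this.trans_lt (h m hm n hn)
  choose U hU using fun μ => cauchySeq_tendsto_of_complete (hcauchy μ)
  choose Φ hΦ using fun μ => cauchySeq_tendsto_of_complete (hcauchy' μ)
  obtain ⟨K, hK⟩ : ∃ K, ∀ᶠ n in atTop, (N α (u n).1).toReal ≤ K := by
    obtain ⟨n₀, h⟩ := hu 1 one_pos
    refine ⟨1 + (N α (u n₀).1).toReal, ?_⟩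
    filter_upwards [eventually_ge_atTop n₀] with n hn
    have htri := toReal_N_add_le hα (u n - u n₀) (u n₀)
    rw [sub_add_cancel] at htri
    exact htri.trans (add_le_add_left (h n hn n₀ le_rfl).le _)
  have hGrad : ∀ μ, HasGrad U μ (Φ μ) := fun μ =>
    hasGrad_of_tendsto hα (fun n => (u n).2.1) (fun n => hfin (u n)) hK hU (hΦ μ)
  -- Uniqueness of the gradient identifies the chosen `grad U` with the limit field.
  have hgradU : grad U = Φ := funext fun μ => (hGrad μ).grad_eq
  have hNU : N α U < ∞ := (N_le_of_tendsto (fun n => hfin (u n)) hK hU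
    (by rwa [hgradU])).trans_lt ENNReal.ofReal_lt_top
  have hmem : U ∈ boundedC1α d α :=
    ⟨⟨fun μ => ⟨_, hGrad μ⟩, (Iα_le_N α U).trans_lt hNU⟩, _, abs_le_N hNU⟩
  refine ⟨⟨U, hmem⟩, Metric.tendsto_atTop.2 fun ε hε => ?_⟩
  -- The factor `3` from `N_le_of_tendsto` leaves `3 * (ε / 4) < ε`.
  obtain ⟨n₀, h⟩ := hu (ε / 4) (by positivity)
  refine ⟨n₀, fun n hn => ?_⟩
  have hle : N α (u n - ⟨U, hmem⟩).1 ≤ ENNReal.ofReal (3 * (ε / 4)) := by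
    -- Here `n` is fixed and `m` tends to infinity, so the Cauchy bound passes to the limit.
    refine N_le_of_tendsto (u := fun m => (u n - u m).1) (fun m => hfin _) ?_ (fun μ => ?_)
      fun μ => ?_
    · filter_upwards [eventually_ge_atTop n₀] with m hm
      exact (h n hn m hm).le
    · exact tendsto_const_nhds.sub (hU μ)
    · simp only [hgsub, hgradU]
      exact tendsto_const_nhds.sub (hΦ μ)
  rw [Real.dist_eq, sub_zero, abs_of_nonneg ENNReal.toReal_nonneg]
  exact (ENNReal.toReal_le_of_le_ofReal (by positivity) hle).trans_lt (by linarith)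

end WassersteinC1

end

theorem mainTheorem8 (d : ℕ) (α : ℝ) (hα : 0 < α) (hα' : α ≤ 1) :
    ∃ S : Submodule ℝ (WassersteinC1.P2 d → ℝ),
      (∀ U, U ∈ S ↔ WassersteinC1.IsC1α α U ∧ WassersteinC1.IsBdd U) ∧
      (∀ U ∈ S, WassersteinC1.N α U < ∞) ∧
      @NormedSpace.Core ℝ S _ _ _ ⟨fun U => (WassersteinC1.N α U.1).toReal⟩ ∧
      (∀ u : ℕ → S,
        (∀ ε : ℝ, 0 < ε → ∃ n₀ : ℕ, ∀ m ≥ n₀, ∀ n ≥ n₀,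
          (WassersteinC1.N α (u m - u n).1).toReal < ε) →
        ∃ U : S, Tendsto (fun n => (WassersteinC1.N α (u n - U).1).toReal) atTop (𝓝 0)) := by
  exact ⟨WassersteinC1.boundedC1α d α, fun _ => Iff.rfl, fun _ hU => hU.1.N_lt_top hα hU.2,
    WassersteinC1.normedSpaceCore hα, WassersteinC1.exists_tendsto_N hα⟩
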